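/- Let $k$ be an algebraically closed field (of any characteristic), and let $\tilde f(t_2,t_2')\in k[t_2,t_2']$ and $\tilde g(t_1,t_1')\in k[t_1,t_1']$ be polynomials that are not both zero. Let $t\ge 0$ be an integer such that the polynomial \[(t_2-t_2')^2\tilde f(t_2,t_2')-(t_1-t_1')^2\tilde g(t_1,t_1')\in k[t_1,t_1',t_2,t_2']\] has at most $t$ distinct irreducible factors (up to multiplication by units). Consider the variety (closed subscheme) \[X=V\bigl(s(t_1-t_1')+(t_2-t_2')\tilde f(t_2,t_2'),\; s(t_2-t_2')+(t_1-t_1')\tilde g(t_1,t_1')\bigr)\subset\mathbb{A}^5_k\] with coordinates $s,t_1,t_1',t_2,t_2'$ on $\mathbb{A}^5_k$. Then $\dim X=3$, and $X$ has at most $t+1$ irreducible components of dimension $3$. -/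

import Mathlib

open MvPolynomial AlgebraicGeometry

universe u

/-- The polynomial `(t₂ - t₂')² f(t₂, t₂') - (t₁ - t₁')² g(t₁, t₁')` in `k[t₁, t₁', t₂, t₂']`.
The variables `t₁, t₁', t₂, t₂'` are `X 0, X 1, X 2, X 3`, in this order. -/
noncomputable def mixedPolynomial {k : Type u} [Field k] (f g : MvPolynomial (Fin 2) k) :
    MvPolynomial (Fin 4) k :=
  (X 2 - X 3) ^ 2 * rename ![2, 3] f - (X 0 - X 1) ^ 2 * rename ![0, 1] g

/-- The first equation `s (t₁ - t₁') + (t₂ - t₂') f(t₂, t₂')` in `k[s, t₁, t₁', t₂, t₂']`.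
The variables `s, t₁, t₁', t₂, t₂'` are `X 0, X 1, X 2, X 3, X 4`, in this order. -/
noncomputable def mixedEquation₁ {k : Type u} [Field k] (f : MvPolynomial (Fin 2) k) :
    MvPolynomial (Fin 5) k :=
  X 0 * (X 1 - X 2) + (X 3 - X 4) * rename ![3, 4] f

/-- The second equation `s (t₂ - t₂') + (t₁ - t₁') g(t₁, t₁')` in `k[s, t₁, t₁', t₂, t₂']`,
with the same order of the variables as in `mixedEquation₁`. -/
noncomputable def mixedEquation₂ {k : Type u} [Field k] (g : MvPolynomial (Fin 2) k) :
    MvPolynomial (Fin 5) k :=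
  X 0 * (X 3 - X 4) + (X 1 - X 2) * rename ![1, 2] g

/-- The closed subscheme `X` of affine 5-space over `k` cut out by the two equations:
the spectrum of `k[s, t₁, t₁', t₂, t₂']` modulo the ideal that they generate. -/
noncomputable def mixedVariety {k : Type u} [Field k] (f g : MvPolynomial (Fin 2) k) :
    Scheme.{u} :=
  Spec (CommRingCat.of
    (MvPolynomial (Fin 5) k ⧸ Ideal.span {mixedEquation₁ f, mixedEquation₂ g}))

/-- The set of irreducible factors of `P`, taken up to associates (so each distinct
factor occurs once, whatever its multiplicity). -/
def irreducibleFactors {R : Type u} [CommRing R] (P : R) : Set (Associates R) :=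
  {p | Irreducible p ∧ p ∣ Associates.mk P}

/-- The irreducible components of a topological space `Y` whose dimension is the dimension
of `Y`. -/
def topDimensionalComponents (Y : Type u) [TopologicalSpace Y] : Set (Set Y) :=
  {Z | Z ∈ irreducibleComponents Y ∧ topologicalKrullDim Z = topologicalKrullDim Y}

/-! Both equations are linear in `s`: they read `a s + c` and `b s + d` with `a = t₁ - t₁'` and `b =
t₂ - t₂'`. Eliminating `s` puts the resultant `b c - a d`, which is `mixedPolynomial f g`, into the
ideal, so every prime over the ideal contains a prime factor `q` of it. Off the linear space `a = b
= 0` the equations determine `s` as `-c/a` or `-d/b`. A component not inside that space is therefore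
the closure of a graph over `q = 0`; this gives at most one component per `q`, plus possibly the
space itself (`encard_minimalPrimes_le`). For the dimension, `q` cannot divide both `a` and `b`, so
each prime over the ideal strictly contains `(q)` and the dimension is at most `5 - 2`
(`ringKrullDim_le_of_exists_prime`). Equality holds because `X` contains the 3-dimensional space `a
= b = 0`. -/

/-! ### Primes over two equations linear in one variable -/

section LinearPencil

variable {R : Type*} [CommRing R]

/-- Modulo `a * T + c`, every polynomial becomes constant after multiplication by a power
of `a`. -/
lemma exists_pow_mul_sub_C_mem_span (a c : R) (h : Polynomial R) :
    ∃ (n : ℕ) (r : R), Polynomial.C a ^ n * h - Polynomial.C r ∈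
      Ideal.span {Polynomial.X * Polynomial.C a + Polynomial.C c} := by
  induction h using Polynomial.induction_on' with
  | add p q hp hq =>
    obtain ⟨n, r, hr⟩ := hp
    obtain ⟨m, s, hs⟩ := hq
    refine ⟨n + m, a ^ m * r + a ^ n * s, ?_⟩
    have := Ideal.add_mem _ (Ideal.mul_mem_left _ (Polynomial.C a ^ m) hr)
      (Ideal.mul_mem_left _ (Polynomial.C a ^ n) hs)
    convert this using 1
    simp only [map_add, map_mul, map_pow]
    ring
  | monomial n r =>
    induction n with
    | zero => exact ⟨0, r, by simp⟩
    | succ n ih =>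
      obtain ⟨m, s, hs⟩ := ih
      -- One more factor `T` costs one more factor `a`, since `a T` is congruent to `-c`.
      refine ⟨m + 1, -c * s, ?_⟩
      have := Ideal.add_mem _
        (Ideal.mul_mem_left _ (Polynomial.X * Polynomial.C a) hs)
        (Ideal.mul_mem_left _ (Polynomial.C s) (Ideal.mem_span_singleton_self
          (Polynomial.X * Polynomial.C a + Polynomial.C c)))
      convert this using 1
      simp only [← Polynomial.C_mul_X_pow_eq_monomial, map_mul, map_neg]
      ring

/-- Once `a` is invertible, `T = -c/a`, so a prime avoiding `a` is controlled by its constants. -/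
lemma le_of_comap_C_le {a c : R} {p p' : Ideal (Polynomial R)} [p'.IsPrime]
    (hp : Polynomial.X * Polynomial.C a + Polynomial.C c ∈ p)
    (hp' : Polynomial.X * Polynomial.C a + Polynomial.C c ∈ p')
    (ha : Polynomial.C a ∉ p') (h : p.comap Polynomial.C ≤ p'.comap Polynomial.C) : p ≤ p' := by
  intro x hx
  obtain ⟨n, r, hr⟩ := exists_pow_mul_sub_C_mem_span a c x
  have h₁ := (Ideal.span_singleton_le_iff_mem p).2 hp hr
  have h₂ := (Ideal.span_singleton_le_iff_mem p').2 hp' hr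
  have hrp : Polynomial.C r ∈ p := by
    simpa using Ideal.sub_mem _ (Ideal.mul_mem_left _ (Polynomial.C a ^ n) hx) h₁
  have h₃ : Polynomial.C a ^ n * x ∈ p' := by
    simpa using Ideal.add_mem _ h₂ (h hrp)
  exact (‹p'.IsPrime›.mem_or_mem h₃).resolve_left fun h₄ ↦ ha (‹p'.IsPrime›.mem_of_pow_mem _ h₄)

/-- A minimal prime over `(a T + c, b T + d)` which contains a prime divisor `q` of the
resultant `b c - a d` but not `a` lies over `(q)`. -/
lemma comap_C_eq_span_of_mem_minimalPrimes {a b c d q : R} (hq : Prime q)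
    (hqP : q ∣ b * c - a * d) {p : Ideal (Polynomial R)}
    (hp : p ∈ (Ideal.span {Polynomial.X * Polynomial.C a + Polynomial.C c,
      Polynomial.X * Polynomial.C b + Polynomial.C d}).minimalPrimes)
    (ha : Polynomial.C a ∉ p) (hqp : Polynomial.C q ∈ p) :
    p.comap Polynomial.C = Ideal.span {q} := by
  have hprime : p.IsPrime := hp.isPrime
  have hI := hp.le
  have hE : Polynomial.X * Polynomial.C a + Polynomial.C c ∈ p :=
    hI (Ideal.subset_span (by simp))
  have : (Ideal.span {q}).IsPrime := (Ideal.span_singleton_prime hq.ne_zero).2 hq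
  have haq : a ∉ Ideal.span {q} := fun h ↦ ha <| by
    obtain ⟨r, rfl⟩ := Ideal.mem_span_singleton.1 h
    rw [map_mul]
    exact Ideal.mul_mem_right _ _ hqp
  let K := FractionRing (R ⧸ Ideal.span {q})
  let ι : R →+* K := (algebraMap (R ⧸ Ideal.span {q}) K).comp (Ideal.Quotient.mk _)
  have hι (r : R) : ι r = 0 ↔ r ∈ Ideal.span {q} := by
    simp [ι, Ideal.Quotient.eq_zero_iff_mem]
  have ha0 : ι a ≠ 0 := fun h ↦ haq ((hι a).1 h)
  have hP : ι b * ι c - ι a * ι d = 0 := by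
    rw [← map_mul, ← map_mul, ← map_sub, hι]
    exact Ideal.mem_span_singleton.2 hqP
  -- The point `T = -c/a` over the generic point of `q = 0`; the second equation holds there because
  -- the resultant vanishes modulo `q`.
  obtain ⟨x, hx⟩ : ∃ x, x * ι a = -ι c := ⟨-ι c / ι a, div_mul_cancel₀ _ ha0⟩
  let φ : Polynomial R →+* K := Polynomial.eval₂RingHom ι x
  have hφC (r : R) : φ (Polynomial.C r) = ι r := by simp [φ]
  have hφX : φ Polynomial.X = x := by simp [φ]
  have hφ : φ (Polynomial.X * Polynomial.C a + Polynomial.C c) = 0 := by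
    rw [map_add, map_mul, hφC, hφC, hφX, hx, neg_add_cancel]
  have hφ' : φ (Polynomial.X * Polynomial.C b + Polynomial.C d) = 0 := by
    rw [map_add, map_mul, hφC, hφC, hφX]
    refine (mul_eq_zero_iff_right ha0).1 ?_
    linear_combination ι b * hx - hP
  have hcomap : (RingHom.ker φ).comap Polynomial.C = Ideal.span {q} := by
    ext r
    rw [Ideal.mem_comap, RingHom.mem_ker, hφC, hι]
  have hker : RingHom.ker φ ≤ p := by
    refine le_of_comap_C_le hφ hE ha ?_
    rw [hcomap, Ideal.span_singleton_le_iff_mem]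
    exact hqp
  -- The kernel is a prime over the ideal and lies in `p`, so minimality of `p` forces equality.
  have hle : p ≤ RingHom.ker φ := by
    refine hp.2 ⟨RingHom.ker_isPrime φ, Ideal.span_le.2 ?_⟩ hker
    rintro x (rfl | rfl)
    exacts [hφ, hφ']
  rw [le_antisymm hle hker, hcomap]

lemma C_resultant_mem {a b c d : R} {p : Ideal (Polynomial R)}
    (hp : Ideal.span {Polynomial.X * Polynomial.C a + Polynomial.C c,
      Polynomial.X * Polynomial.C b + Polynomial.C d} ≤ p) :
    Polynomial.C (b * c - a * d) ∈ p := by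
  have h₁ := hp (Ideal.subset_span (Set.mem_insert _ _))
  have h₂ := hp (Ideal.subset_span (Set.mem_insert_of_mem _ rfl))
  have := Ideal.sub_mem _ (Ideal.mul_mem_left _ (Polynomial.C b) h₁)
    (Ideal.mul_mem_left _ (Polynomial.C a) h₂)
  convert this using 1
  simp only [map_sub, map_mul]
  ring

lemma exists_prime_dvd_resultant_C_mem [IsDomain R] [UniqueFactorizationMonoid R] {a b c d : R}
    (hP : b * c - a * d ≠ 0) {p : Ideal (Polynomial R)} [p.IsPrime]
    (hp : Ideal.span {Polynomial.X * Polynomial.C a + Polynomial.C c,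
      Polynomial.X * Polynomial.C b + Polynomial.C d} ≤ p) :
    ∃ q, Prime q ∧ q ∣ b * c - a * d ∧ Polynomial.C q ∈ p := by
  have hmem : b * c - a * d ∈ p.comap Polynomial.C := C_resultant_mem hp
  have hprime : (p.comap (Polynomial.C (R := R))).IsPrime := inferInstance
  obtain ⟨m, hm, hassoc⟩ := UniqueFactorizationMonoid.exists_prime_factors _ hP
  obtain ⟨u, hu⟩ := hassoc.symm
  rw [← Ideal.unit_mul_mem_iff_mem _ u.isUnit, mul_comm, hu,
    hprime.multiset_prod_mem_iff_exists_mem] at hmem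
  obtain ⟨q, hqm, hqp⟩ := hmem
  exact ⟨q, hm q hqm, (Multiset.dvd_prod hqm).trans hassoc.dvd, hqp⟩

/-- The ideal `(a T + c, b T + d)` has at most one more minimal prime than the resultant
`b c - a d` has prime factors. -/
lemma encard_minimalPrimes_le {R : Type u} [CommRing R] [IsDomain R]
    [UniqueFactorizationMonoid R] {a b c d : R} (hP : b * c - a * d ≠ 0)
    (h₀ : (Ideal.span {Polynomial.C a, Polynomial.C b}).IsPrime)
    (hI : Ideal.span {Polynomial.X * Polynomial.C a + Polynomial.C c,
      Polynomial.X * Polynomial.C b + Polynomial.C d} ≤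
        Ideal.span {Polynomial.C a, Polynomial.C b}) :
    (Ideal.span {Polynomial.X * Polynomial.C a + Polynomial.C c,
      Polynomial.X * Polynomial.C b + Polynomial.C d}).minimalPrimes.encard ≤
        (irreducibleFactors (b * c - a * d)).encard + 1 := by
  set I := Ideal.span {Polynomial.X * Polynomial.C a + Polynomial.C c,
      Polynomial.X * Polynomial.C b + Polynomial.C d} with hIdef
  set p₀ := Ideal.span {Polynomial.C a, Polynomial.C b}
  let S : Set (Ideal (Polynomial R)) := {p ∈ I.minimalPrimes | ¬ p₀ ≤ p}
  have hsub : I.minimalPrimes ⊆ insert p₀ S := by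
    intro p hp
    by_cases h : p₀ ≤ p
    · exact Or.inl (le_antisymm (hp.2 ⟨h₀, hI⟩ h) h)
    · exact Or.inr ⟨hp, h⟩
  have hnot {p} (h : ¬ p₀ ≤ p) : Polynomial.C a ∉ p ∨ Polynomial.C b ∉ p := by
    by_contra! h'
    refine h (Ideal.span_le.2 ?_)
    rintro x (rfl | rfl)
    exacts [h'.1, h'.2]
  have hq (p : Ideal (Polynomial R)) (hp : p ∈ S) :
      ∃ q, Prime q ∧ q ∣ b * c - a * d ∧ p.comap Polynomial.C = Ideal.span {q} := by
    have hprime := hp.1.isPrime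
    obtain ⟨q, hq, hqP, hqp⟩ := exists_prime_dvd_resultant_C_mem hP hp.1.le
    refine ⟨q, hq, hqP, ?_⟩
    rcases hnot hp.2 with ha | hb
    · exact comap_C_eq_span_of_mem_minimalPrimes hq hqP hp.1 ha hqp
    -- Exchanging the two equations only changes the sign of the resultant.
    · refine comap_C_eq_span_of_mem_minimalPrimes (b := a) (c := d) (d := c) hq ?_ ?_ hb hqp
      · rwa [← dvd_neg, neg_sub]
      · rw [Set.pair_comm]
        exact hp.1
  choose! Q hQprime hQdvd hQ using hq
  refine (Set.encard_le_encard hsub).trans ((Set.encard_insert_le _ _).trans ?_)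
  gcongr
  -- A minimal prime other than `p₀` is recovered from its contraction `(q)`.
  refine Set.encard_le_encard_of_injOn (f := fun p ↦ Associates.mk (Q p)) ?_ ?_
  · intro p hp
    exact ⟨(Associates.irreducible_mk).2 (hQprime p hp).irreducible,
      Associates.mk_le_mk_of_dvd (hQdvd p hp)⟩
  · intro p hp p' hp' h
    have hcomap : p.comap Polynomial.C = p'.comap Polynomial.C := by
      rw [hQ p hp, hQ p' hp', Ideal.span_singleton_eq_span_singleton]
      exact Associates.mk_eq_mk_iff_associated.1 h
    have hmem (r : R) : Polynomial.C r ∈ p ↔ Polynomial.C r ∈ p' := by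
      rw [← Ideal.mem_comap, hcomap, Ideal.mem_comap]
    have hprime := hp.1.isPrime
    have hprime' := hp'.1.isPrime
    have h₁ : Polynomial.X * Polynomial.C a + Polynomial.C c ∈ I :=
      Ideal.subset_span (Set.mem_insert _ _)
    have h₂ : Polynomial.X * Polynomial.C b + Polynomial.C d ∈ I :=
      Ideal.subset_span (Set.mem_insert_of_mem _ rfl)
    rcases hnot hp.2 with ha | hb
    · exact le_antisymm
        (le_of_comap_C_le (hp.1.le h₁) (hp'.1.le h₁) (by rwa [← hmem]) hcomap.le)
        (le_of_comap_C_le (hp'.1.le h₁) (hp.1.le h₁) ha hcomap.ge)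
    · exact le_antisymm
        (le_of_comap_C_le (hp.1.le h₂) (hp'.1.le h₂) (by rwa [← hmem]) hcomap.le)
        (le_of_comap_C_le (hp'.1.le h₂) (hp.1.le h₂) hb hcomap.ge)

end LinearPencil

/-- If every prime over the kernel of a surjection `S → A` strictly contains a nonzero principal
prime, then the dimension drops by at least two. -/
lemma ringKrullDim_le_of_exists_prime {S A : Type*} [CommRing S] [IsDomain S] [CommRing A]
    {π : S →+* A} (hπ : Function.Surjective π)
    (h : ∀ p : Ideal S, p.IsPrime → RingHom.ker π ≤ p → ∃ q ∈ p, Prime q ∧ p ≠ Ideal.span {q})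
    {n : ℕ} (hn : ringKrullDim S ≤ (n + 2 : ℕ)) : ringKrullDim A ≤ n := by
  refine iSup_le fun l ↦ ?_
  let φ : PrimeSpectrum A → PrimeSpectrum S := PrimeSpectrum.comap π
  have hφ : StrictMono φ := by
    refine Monotone.strictMono_of_injective (fun _ _ h ↦ Ideal.comap_mono h) ?_
    exact PrimeSpectrum.comap_injective_of_surjective π hπ
  let l₁ : LTSeries (PrimeSpectrum S) := l.map φ hφ
  obtain ⟨q, hqp, hq, hne⟩ := h l₁.head.asIdeal l₁.head.isPrime
    (Ideal.comap_mono (bot_le (a := l.head.asIdeal)))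
  -- The primes `0 < (q)` prolong the lifted chain downwards by two steps.
  let P₁ : PrimeSpectrum S :=
    ⟨Ideal.span {q}, (Ideal.span_singleton_prime hq.ne_zero).2 hq⟩
  let P₀ : PrimeSpectrum S := ⟨⊥, Ideal.isPrime_bot⟩
  have h₁ : P₁ < l₁.head := by
    refine lt_of_le_of_ne ((Ideal.span_singleton_le_iff_mem _).2 hqp) fun h ↦ hne ?_
    rw [← h]
  have h₀ : P₀ < P₁ := by
    refine lt_of_le_of_ne bot_le fun h ↦ hq.ne_zero ?_
    have : (⊥ : Ideal S) = Ideal.span {q} := congr_arg PrimeSpectrum.asIdeal h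
    exact Ideal.span_singleton_eq_bot.1 this.symm
  let l₂ : LTSeries (PrimeSpectrum S) := (l₁.cons P₁ h₁).cons P₀ (by simpa using h₀)
  have := (Order.LTSeries.length_le_krullDim l₂).trans hn
  have hlen : l₂.length = l.length + 2 := by simp [l₂, l₁]
  rw [hlen] at this
  have hle : l.length + 2 ≤ n + 2 := by exact_mod_cast this
  exact_mod_cast Nat.le_of_add_le_add_right hle

/-! ### The diagonals in `k[t₁, t₁', t₂, t₂']` and the change of variables -/

section DiagonalIdeal

variable {k : Type u} [Field k]

/-- Restriction to the diagonal `t₁ = t₁'`. -/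
noncomputable def restrictLeft : MvPolynomial (Fin 4) k →ₐ[k] MvPolynomial (Fin 4) k :=
  aeval ![X 0, X 0, X 2, X 3]

/-- Restriction to the diagonal `t₂ = t₂'`. -/
noncomputable def restrictRight : MvPolynomial (Fin 4) k →ₐ[k] MvPolynomial (Fin 4) k :=
  aeval ![X 0, X 1, X 2, X 2]

lemma X_sub_X_ne_zero {n : ℕ} {i j : Fin n} (h : i ≠ j) :
    (X i - X j : MvPolynomial (Fin n) k) ≠ 0 :=
  sub_ne_zero.2 fun h' ↦ h (X_injective h')

/-- Restricting to one diagonal kills one term and leaves a nonzero square times `f` or `g`. -/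
lemma mixedPolynomial_ne_zero {f g : MvPolynomial (Fin 2) k} (hfg : ¬ (f = 0 ∧ g = 0)) :
    mixedPolynomial f g ≠ 0 := by
  intro h
  apply hfg
  have hl : restrictLeft (rename ![2, 3] f) = rename ![2, 3] f := by
    rw [restrictLeft, aeval_rename, rename_eq_aeval]
    congr 2
    ext i
    fin_cases i <;> rfl
  have hr : restrictRight (rename ![0, 1] g) = rename ![0, 1] g := by
    rw [restrictRight, aeval_rename, rename_eq_aeval]
    congr 2
    ext i
    fin_cases i <;> rfl
  have h₁ := congr_arg restrictLeft h
  have h₂ := congr_arg restrictRight h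
  rw [mixedPolynomial, map_zero, map_sub, map_mul, map_mul, hl, map_pow, map_pow] at h₁
  rw [mixedPolynomial, map_zero, map_sub, map_mul, map_mul, hr, map_pow, map_pow] at h₂
  have hinj₁ : Function.Injective (![2, 3] : Fin 2 → Fin 4) := by decide
  have hinj₂ : Function.Injective (![0, 1] : Fin 2 → Fin 4) := by decide
  constructor
  · have h₃ : (X 2 - X 3 : MvPolynomial (Fin 4) k) ^ 2 * rename ![2, 3] f = 0 := by
      simpa [restrictLeft] using h₁
    exact (map_eq_zero_iff _ (rename_injective _ hinj₁)).1
      ((mul_eq_zero.1 h₃).resolve_left (pow_ne_zero _ (X_sub_X_ne_zero (by decide))))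
  · have h₃ : (X 0 - X 1 : MvPolynomial (Fin 4) k) ^ 2 * rename ![0, 1] g = 0 := by
      simpa only [restrictRight, map_sub, aeval_X, Matrix.cons_val, sub_self, ne_eq,
        OfNat.ofNat_ne_zero, not_false_eq_true, zero_pow, zero_mul, zero_sub, neg_eq_zero] using h₂
    exact (map_eq_zero_iff _ (rename_injective _ hinj₂)).1
      ((mul_eq_zero.1 h₃).resolve_left (pow_ne_zero _ (X_sub_X_ne_zero (by decide))))

lemma X_sub_X_isRelPrime {q : MvPolynomial (Fin 4) k} (hq : Prime q) (h₁ : q ∣ X 0 - X 1)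
    (h₂ : q ∣ X 2 - X 3) : False := by
  have hirr : Irreducible (X 0 - X 1 : MvPolynomial (Fin 4) k) := by
    have := irreducible_mul_X_add (1 : MvPolynomial (Fin 4) k) (-X 1) 0 one_ne_zero
      (by simp) (by simp) isRelPrime_one_left
    rwa [one_mul, ← sub_eq_add_neg] at this
  have hdvd : (X 0 - X 1 : MvPolynomial (Fin 4) k) ∣ X 2 - X 3 :=
    (hq.irreducible.associated_of_dvd hirr h₁).symm.dvd.trans h₂
  have := map_dvd restrictLeft hdvd
  rw [show restrictLeft (X 0 - X 1 : MvPolynomial (Fin 4) k) = 0 by simp [restrictLeft],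
    show restrictLeft (X 2 - X 3 : MvPolynomial (Fin 4) k) = X 2 - X 3 by simp [restrictLeft],
    zero_dvd_iff] at this
  exact X_sub_X_ne_zero (by decide) this

lemma isPrime_span_X_sub_X :
    (Ideal.span {X 0 - X 1, X 2 - X 3} : Ideal (MvPolynomial (Fin 4) k)).IsPrime := by
  let φ : MvPolynomial (Fin 4) k →ₐ[k] MvPolynomial (Fin 4) k := aeval ![X 0, X 0, X 2, X 2]
  suffices h : Ideal.span {X 0 - X 1, X 2 - X 3} = RingHom.ker φ by
    rw [h]
    exact RingHom.ker_isPrime φ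
  apply le_antisymm
  · refine Ideal.span_le.2 ?_
    rintro x (rfl | rfl) <;> simp [φ]
  · intro x hx
    -- The substitution changes no class modulo the ideal, so its kernel lies in the ideal.
    have : (Ideal.Quotient.mkₐ k (Ideal.span {X 0 - X 1, X 2 - X 3})).comp φ =
        Ideal.Quotient.mkₐ k (Ideal.span {X 0 - X 1, X 2 - X 3}) := by
      ext i
      rw [AlgHom.comp_apply, aeval_X]
      refine Ideal.Quotient.eq.2 ?_
      fin_cases i
      · simp
      · exact Ideal.subset_span (by simp)
      · simp
      · exact Ideal.subset_span (by simp)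
    have h := DFunLike.congr_fun this x
    rw [AlgHom.comp_apply, (show φ x = 0 from hx), map_zero] at h
    exact Ideal.Quotient.eq_zero_iff_mem.1 h.symm

lemma finSuccEquiv_rename_succ_comp {σ : Type*} {n : ℕ} (v : σ → Fin n)
    (p : MvPolynomial σ k) :
    finSuccEquiv k n (rename (Fin.succ ∘ v) p) = Polynomial.C (rename v p) := by
  induction p using MvPolynomial.induction_on with
  | C a => simp [finSuccEquiv_apply]
  | add p q hp hq => simp only [map_add, hp, hq]
  | mul_X p i hp =>
    simp only [map_mul, hp, rename_X, Function.comp_apply, finSuccEquiv_X_succ]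

lemma finSuccEquiv_mixedEquation₁ (f : MvPolynomial (Fin 2) k) :
    finSuccEquiv k 4 (mixedEquation₁ f) = Polynomial.X * Polynomial.C (X 0 - X 1) +
      Polynomial.C ((X 2 - X 3) * rename ![2, 3] f) := by
  have h : finSuccEquiv k 4 (rename ![3, 4] f) = Polynomial.C (rename ![2, 3] f) := by
    rw [← finSuccEquiv_rename_succ_comp,
      show (![3, 4] : Fin 2 → Fin 5) = Fin.succ ∘ ![2, 3] by decide]
  have hX (i : Fin 4) : finSuccEquiv k 4 (X i.succ) = Polynomial.C (X i) := finSuccEquiv_X_succ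
  rw [mixedEquation₁, map_add, map_mul, map_mul, h, finSuccEquiv_X_zero, map_sub, map_sub,
    map_mul, map_sub, map_sub]
  exact congr_arg₂ _ (congr_arg₂ _ rfl (congr_arg₂ _ (hX 0) (hX 1)))
    (congr_arg₂ _ (congr_arg₂ _ (hX 2) (hX 3)) rfl)

lemma finSuccEquiv_mixedEquation₂ (g : MvPolynomial (Fin 2) k) :
    finSuccEquiv k 4 (mixedEquation₂ g) = Polynomial.X * Polynomial.C (X 2 - X 3) +
      Polynomial.C ((X 0 - X 1) * rename ![0, 1] g) := by
  have h : finSuccEquiv k 4 (rename ![1, 2] g) = Polynomial.C (rename ![0, 1] g) := by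
    rw [← finSuccEquiv_rename_succ_comp,
      show (![1, 2] : Fin 2 → Fin 5) = Fin.succ ∘ ![0, 1] by decide]
  have hX (i : Fin 4) : finSuccEquiv k 4 (X i.succ) = Polynomial.C (X i) := finSuccEquiv_X_succ
  rw [mixedEquation₂, map_add, map_mul, map_mul, h, finSuccEquiv_X_zero, map_sub, map_sub,
    map_mul, map_sub, map_sub]
  exact congr_arg₂ _ (congr_arg₂ _ rfl (congr_arg₂ _ (hX 2) (hX 3)))
    (congr_arg₂ _ (congr_arg₂ _ (hX 0) (hX 1)) rfl)

end DiagonalIdeal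

/-! ### Dimension and components of the variety -/

section MixedRing

variable {k : Type u} [Field k] (f g : MvPolynomial (Fin 2) k)

/-- The ideal of the variety, in the polynomial ring in `s` over `k[t₁, t₁', t₂, t₂']`. -/
noncomputable def pencilIdeal : Ideal (Polynomial (MvPolynomial (Fin 4) k)) :=
  Ideal.span {Polynomial.X * Polynomial.C (X 0 - X 1) +
      Polynomial.C ((X 2 - X 3) * rename ![2, 3] f),
    Polynomial.X * Polynomial.C (X 2 - X 3) + Polynomial.C ((X 0 - X 1) * rename ![0, 1] g)}

/-- The coordinate ring of the variety. -/
abbrev MixedRing : Type u :=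
  MvPolynomial (Fin 5) k ⧸ Ideal.span {mixedEquation₁ f, mixedEquation₂ g}

/-- The coordinate ring as a quotient of the polynomial ring in `s`. -/
noncomputable def pencilMap : Polynomial (MvPolynomial (Fin 4) k) →+* MixedRing f g :=
  (Ideal.Quotient.mk _).comp (finSuccEquiv k 4).symm.toRingEquiv.toRingHom

lemma pencilMap_surjective : Function.Surjective (pencilMap f g) :=
  Ideal.Quotient.mk_surjective.comp (finSuccEquiv k 4).symm.surjective

lemma ker_pencilMap : RingHom.ker (pencilMap f g) = pencilIdeal f g := by
  have h : pencilIdeal f g = (Ideal.span {mixedEquation₁ f, mixedEquation₂ g}).map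
      (finSuccEquiv k 4).toRingEquiv.toRingHom := by
    rw [Ideal.map_span, Set.image_pair, pencilIdeal, ← finSuccEquiv_mixedEquation₁,
      ← finSuccEquiv_mixedEquation₂]
    rfl
  rw [h, pencilMap, ← RingHom.comap_ker, Ideal.mk_ker]
  exact (Ideal.map_comap_of_equiv (finSuccEquiv k 4).toRingEquiv).symm

lemma resultant_eq_mixedPolynomial : (X 2 - X 3) * ((X 2 - X 3) * rename ![2, 3] f) -
    (X 0 - X 1) * ((X 0 - X 1) * rename ![0, 1] g) = mixedPolynomial f g := by
  rw [mixedPolynomial]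
  ring

variable {f g} in
lemma ringKrullDim_mixedRing_le (hfg : ¬ (f = 0 ∧ g = 0)) : ringKrullDim (MixedRing f g) ≤ 3 := by
  refine ringKrullDim_le_of_exists_prime (pencilMap_surjective f g) ?_ (n := 3) ?_
  · intro p hp hle
    rw [ker_pencilMap] at hle
    obtain ⟨q, hq, -, hqp⟩ := exists_prime_dvd_resultant_C_mem
      (by rw [resultant_eq_mixedPolynomial]; exact mixedPolynomial_ne_zero hfg) hle
    refine ⟨Polynomial.C q, hqp, Polynomial.prime_C_iff.2 hq, ?_⟩
    -- Otherwise `q` divides the coefficients of `s` in both equations, which are coprime.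
    rintro rfl
    have h₁ := hle (Ideal.subset_span (Set.mem_insert _ _))
    have h₂ := hle (Ideal.subset_span (Set.mem_insert_of_mem _ rfl))
    rw [Ideal.mem_span_singleton, Polynomial.C_dvd_iff_dvd_coeff] at h₁ h₂
    exact X_sub_X_isRelPrime hq (by simpa [-map_sub] using h₁ 1) (by simpa [-map_sub] using h₂ 1)
  · rw [← ringKrullDim_eq_of_ringEquiv (finSuccEquiv k 4).toRingEquiv,
      MvPolynomial.ringKrullDim_of_isNoetherianRing, ringKrullDim_eq_zero_of_field]
    simp

/-- Both equations vanish on `t₁ = t₁'`, `t₂ = t₂'`, a copy of affine 3-space. -/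
lemma le_ringKrullDim_mixedRing : 3 ≤ ringKrullDim (MixedRing f g) := by
  let φ : MvPolynomial (Fin 5) k →ₐ[k] MvPolynomial (Fin 3) k := aeval ![X 0, X 1, X 1, X 2, X 2]
  have hφ : Function.Surjective φ := by
    intro x
    refine ⟨rename ![0, 1, 3] x, ?_⟩
    rw [aeval_rename]
    convert aeval_X_left_apply x
    ext i
    fin_cases i <;> rfl
  have hker (x) (hx : x ∈ Ideal.span {mixedEquation₁ f, mixedEquation₂ g}) : φ x = 0 := by
    refine (Ideal.span_le (I := RingHom.ker φ)).2 ?_ hx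
    rintro x (rfl | rfl)
    · simp [φ, mixedEquation₁]
    · simp [φ, mixedEquation₂]
  have h := ringKrullDim_le_of_surjective (Ideal.Quotient.lift _ φ.toRingHom hker)
    (Ideal.Quotient.lift_surjective_of_surjective _ _ hφ)
  rw [MvPolynomial.ringKrullDim_of_isNoetherianRing, ringKrullDim_eq_zero_of_field] at h
  simpa using h

variable {f g} in
lemma encard_irreducibleComponents_le (hfg : ¬ (f = 0 ∧ g = 0)) :
    (irreducibleComponents (PrimeSpectrum (MixedRing f g))).encard ≤
      (irreducibleFactors (mixedPolynomial f g)).encard + 1 := by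
  have h₁ : (irreducibleComponents (PrimeSpectrum (MixedRing f g))).encard =
      (minimalPrimes (MixedRing f g)).encard :=
    (Set.encard_congr (minimalPrimes.equivIrreducibleComponents _).toEquiv).symm
  have h₂ : (minimalPrimes (MixedRing f g)).encard ≤ (pencilIdeal f g).minimalPrimes.encard := by
    rw [← ker_pencilMap, RingHom.ker_eq_comap_bot,
      Ideal.comap_minimalPrimes_eq_of_surjective (pencilMap_surjective f g)]
    exact (Function.Injective.encard_image
      (Ideal.comap_injective_of_surjective _ (pencilMap_surjective f g)) _).ge
  rw [h₁, ← resultant_eq_mixedPolynomial]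
  refine h₂.trans (encard_minimalPrimes_le ?_ ?_ ?_)
  · rw [resultant_eq_mixedPolynomial]
    exact mixedPolynomial_ne_zero hfg
  · have := isPrime_span_X_sub_X (k := k)
    have h := Ideal.isPrime_map_C_of_isPrime
      (P := (Ideal.span {X 0 - X 1, X 2 - X 3} : Ideal (MvPolynomial (Fin 4) k)))
    rwa [Ideal.map_span, Set.image_pair] at h
  · refine Ideal.span_le.2 ?_
    rw [Set.insert_subset_iff, Set.singleton_subset_iff, map_mul, map_mul]
    constructor <;> refine Ideal.add_mem _ (Ideal.mul_mem_left _ _ (Ideal.subset_span ?_))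
      (Ideal.mul_mem_right _ _ (Ideal.subset_span ?_)) <;> simp

end MixedRing

theorem mainTheorem8 {k : Type u} [Field k] [IsAlgClosed k] (f g : MvPolynomial (Fin 2) k)
    (hfg : ¬ (f = 0 ∧ g = 0)) (t : ℕ)
    (ht : (irreducibleFactors (mixedPolynomial f g)).encard ≤ (t : ℕ∞)) :
    topologicalKrullDim (mixedVariety f g) = 3 ∧
      (topDimensionalComponents (mixedVariety f g)).encard ≤ (t : ℕ∞) + 1 := by
  constructor
  · change topologicalKrullDim (PrimeSpectrum (MixedRing f g)) = 3
    rw [PrimeSpectrum.topologicalKrullDim_eq_ringKrullDim]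
    exact le_antisymm (ringKrullDim_mixedRing_le hfg) (le_ringKrullDim_mixedRing f g)
  -- The bound holds for all components, whatever their dimension.
  · refine (Set.encard_le_encard fun Z hZ ↦ hZ.1).trans
      ((encard_irreducibleComponents_le hfg).trans ?_)
    gcongr
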